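/- All graphs are finite, undirected, without loops or parallel edges. **Bounded expansion.** A graph $H$ is a depth-$d$ minor of $G$ if there are pairwise disjoint sets $B_w\subseteq V(G)$ $(w\in V(H))$ such that each induced subgraph $G[B_w]$ has a vertex at distance at most $d$ in $G[B_w]$ from every vertex of $B_w$, and for every edge $ww'$ of $H$ some edge of $G$ joins $B_w$ to $B_{w'}$. A graph class $\mathcal C$ has *bounded expansion* if for every $d\in\mathbb N$ there is $k\in\mathbb N$ such that $|E(H)|\le k\,|V(H)|$ for every depth-$d$ minor $H$ of every $G\in\mathcal C$. **Separation-width.** For $S\subseteq V(G)$ and $v\in V(G)\setminus S$ let $\operatorname{sep}_r(v/S)$ be the set of vertices of $S$ that can be reached from $v$ by a path of length at most $r$ whose inner vertices are not in $S$. Then $\operatorname{sw}_r(G)$ is the least $k$ such that there is a total order $\le$ on $V(G)$ with $|\operatorname{sep}_r(v/S)|\le k$ for every $\le$-downward closed set $S\subseteq V(G)$ and every $v\in V(G)\setminus S$. **Merge-width.** For a partition $\mathcal P$ of $V(G)$, a $\mathcal P$-flip of $G$ is a graph on $V(G)$ obtained from $G$ by choosing a set of unordered pairs $A,B\in\mathcal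 P$ (possibly $A=B$) and, for each chosen pair, inverting the adjacency of all pairs of distinct vertices $a\in A$, $b\in B$. A *restrained flip sequence* of $G$, with $V=V(G)$, is a sequence $(\mathcal P_1,R_1,G_1),\dots,(\mathcal P_m,R_m,G_m)$ in which $\mathcal P_1,\dots,\mathcal P_m$ are successively refining partitions of $V$ from the trivial partition $\mathcal P_1$ to the partition $\mathcal P_m$ into singletons, each $G_i$ is a $\mathcal P_i$-flip of $G$, $\binom V2=R_1\supseteq\dots\supseteq R_m=\emptyset$, and $E(G_i)\subseteq R_i$ for all $i$. Its radius-$r$ width is the maximum, over $i\in\{1,\dots,m-1\}$ and $v\in V$, of the number of parts of $\mathcal P_{i+1}$ that contain a vertex reachable from $v$ by a path of length at most $r$ in the graph $(V,R_i)$ (and $0$ if there is no such $i$ or $v$). The *radius-$r$ merge-width* $\operatorname{mw}_r(G)$ is the least radius-$r$ width of a restrained flip sequence of $G$. **Corollary 6.4.** For every graph class $\mathcal C$ of bounded expansion there is a constant $c$, depending only on $\mathcal C$, such that for every $r\ge 1$ and every $G\in\mathcal C$, $$\operatorname{mw}_r(G)\le c\cdot\max\{1,\operatorname{sw}_{r+1}(G)\}.$$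 (So $\operatorname{mw}_r(G)\le c\cdot \operatorname{sw}_{r+1}(G)$ whenever $G$ has at least one edge.) -/

import Mathlib

universe u

namespace SparseMerge

/-! ### Classes of bounded expansion -/

/-- A class of finite simple graphs; `C V G` means that the graph `G` on the finite vertex set `V`
belongs to the class. -/
def GraphClass : Type (u + 1) :=
  ∀ (V : Type u) [Finite V], SimpleGraph V → Prop

/-- `H` is a depth-`d` (shallow) minor of `G`: there are pairwise disjoint branch sets `B w`, each
of radius at most `d` as an induced subgraph of `G` (so connected and nonempty), such that adjacent
vertices of `H` have branch sets joined by an edge of `G`. -/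
def IsShallowMinor {W V : Type u} (d : ℕ) (H : SimpleGraph W) (G : SimpleGraph V) : Prop :=
  ∃ B : W → Set V,
    (∀ a b : W, a ≠ b → Disjoint (B a) (B b)) ∧
    (∀ a : W, ∃ c : B a, ∀ x : B a, ∃ p : (G.induce (B a)).Walk c x, p.length ≤ d) ∧
    (∀ a b : W, H.Adj a b → ∃ x ∈ B a, ∃ y ∈ B b, G.Adj x y)

/-- A class has bounded expansion if for every depth `d`, the edge density `|E(H)| / |V(H)|` of all
(nonempty) depth-`d` minors `H` of members of the class is bounded by a constant. -/
def GraphClass.BoundedExpansion (C : GraphClass.{u}) : Prop :=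
  ∀ d : ℕ, ∃ k : ℕ, ∀ (V : Type u) [Finite V] (G : SimpleGraph V), C V G →
    ∀ (W : Type u) [Finite W] (H : SimpleGraph W), IsShallowMinor d H G →
      H.edgeSet.ncard ≤ k * Nat.card W

/-! ### Separation-width -/

variable {V : Type u}

/-- The `r`-separator of `v` in `S` (used for `v ∉ S`): the vertices of `S` that can be reached from
`v` by a path of length at most `r` whose inner vertices are not in `S`. -/
def sep (G : SimpleGraph V) (r : ℕ∞) (v : V) (S : Set V) : Set V :=
  {u | u ∈ S ∧ ∃ p : G.Walk v u, p.IsPath ∧ (p.length : ℕ∞) ≤ r ∧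
    ∀ w ∈ p.support, w ≠ v → w ≠ u → w ∉ S}

/-- The largest size of an `r`-separator of a vertex `v` in a downward closed set `S` with `v ∉ S`,
with respect to a given total order on the vertices. -/
noncomputable def orderSepWidth [LinearOrder V] (G : SimpleGraph V) (r : ℕ∞) : ℕ∞ :=
  ⨆ (S : Set V) (_ : IsLowerSet S) (v : V) (_ : v ∉ S), (sep G r v S).encard

/-- The radius-`r` separation-width of `G`: the minimum over all total orders on the vertices. -/
noncomputable def sw (r : ℕ∞) (G : SimpleGraph V) : ℕ∞ :=
  ⨅ L : LinearOrder V, @orderSepWidth V L G r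

/-! ### Merge-width

Partitions of `V` are represented by equivalence relations (`P ≤ Q` says that `P` refines `Q`), and
sets of unordered pairs of distinct vertices by simple graphs on `V`. -/

/-- `H` is a `P`-flip of `G`: for some set `F` of unordered pairs of (possibly equal) parts of `P`,
`H` is obtained from `G` by flipping the adjacency within each of the pairs in `F`. -/
def IsFlip (P : Setoid V) (G H : SimpleGraph V) : Prop :=
  ∃ F : Set (Sym2 (Quotient P)), ∀ u v : V, u ≠ v →
    (H.Adj u v ↔ Xor (G.Adj u v) (s(Quotient.mk P u, Quotient.mk P v) ∈ F))

/-- A restrained flip sequence `(P 0, R 0, G 0), …, (P len, R len, G len)` for `G`. -/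
structure RestrainedFlipSequence (G : SimpleGraph V) where
  /-- One less than the number of triples. -/
  len : ℕ
  /-- The partitions. -/
  part : Fin (len + 1) → Setoid V
  /-- The sets of pairs. -/
  res : Fin (len + 1) → SimpleGraph V
  /-- The flips. -/
  flip : Fin (len + 1) → SimpleGraph V
  part_refines : Antitone part
  part_first : part 0 = ⊤
  part_last : part (Fin.last len) = ⊥
  isFlip : ∀ i, IsFlip (part i) G (flip i)
  res_decreasing : Antitone res
  res_first : res 0 = ⊤
  res_last : res (Fin.last len) = ⊥
  flip_le_res : ∀ i, flip i ≤ res i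

/-- The parts of `P` that are `r`-reachable from `v` in the graph `(V, R)`. -/
def reachableParts (P : Setoid V) (R : SimpleGraph V) (r : ℕ) (v : V) : Set (Set V) :=
  {A | A ∈ P.classes ∧ ∃ u ∈ A, ∃ p : R.Walk v u, p.IsPath ∧ p.length ≤ r}

/-- The radius-`r` width of `(P, R)`. -/
noncomputable def pairWidth (r : ℕ) (P : Setoid V) (R : SimpleGraph V) : ℕ∞ :=
  ⨆ v : V, (reachableParts P R r v).encard

/-- The radius-`r` width of a restrained flip sequence: the maximum of the widths of the pairs
consisting of a partition and the preceding set of pairs. -/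
noncomputable def RestrainedFlipSequence.width {G : SimpleGraph V}
    (σ : RestrainedFlipSequence G) (r : ℕ) : ℕ∞ :=
  ⨆ i : Fin σ.len, pairWidth r (σ.part i.succ) (σ.res i.castSucc)

/-- The radius-`r` merge-width of `G`: the minimum over all restrained flip sequences of `G`. -/
noncomputable def mw (r : ℕ) (G : SimpleGraph V) : ℕ∞ :=
  ⨅ σ : RestrainedFlipSequence G, σ.width r

end SparseMerge

namespace SparseMerge

/-! Fix an order attaining the separation-width and isolate its vertices one at a time. For an
initial segment `S`, use singletons on `S` and classes of equal neighbourhood in `S` elsewhere.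
Adjacency between two parts is constant as soon as one of them lies in `S`, so deleting all edges at
`S` is a flip (`isFlip_isolate`).

A vertex within distance `r` of `v` in `G - S` has all its `S`-neighbours in the `(r + 1)`-separator
`X` of `v` (`mem_sep_of_walk_isolate`), so its class is determined by its trace on `X`. Bounded
expansion makes the number of traces linear in `|X|` (`card_traces_le`). The next partition knows
one more vertex, which costs a factor of at most 4 (`pairWidth_le`). -/

/-! ### Linear neighbourhood complexity from sparse depth-1 minors -/

open Finset Classical in
/-- A graph whose induced subgraphs on subsets of `X` all have at most `k` edges per vertex has at
most `4 ^ k * |X| + 1` cliques inside `X`. -/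
theorem card_cliques_le [Fintype V] (H : SimpleGraph V) (k : ℕ) (X : Finset V)
    (hH : ∀ W ⊆ X, (H.induce (W : Set V)).edgeSet.ncard ≤ k * #W) :
    #(X.powerset.filter fun Q : Finset V => H.IsClique (Q : Set V)) ≤ 4 ^ k * #X + 1 := by
  induction X using Finset.strongInduction with
  | H X ih =>
    rcases X.eq_empty_or_nonempty with rfl | hX
    · exact (card_filter_le _ _).trans (by simp)
    -- The average degree on `X` is at most `2 * k`. A clique either avoids `x`, and is counted by
    -- induction, or is `x` plus one of at most `2 ^ (2 * k) = 4 ^ k` sets of neighbours.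
    obtain ⟨x, hx, hdeg⟩ : ∃ x ∈ X, #{y ∈ X | H.Adj x y} ≤ 2 * k := by
      by_contra! hcon
      have hsum := (H.induce (X : Set V)).sum_degrees_eq_twice_card_edges
      have hle := hH X subset_rfl
      rw [Set.ncard_eq_toFinset_card', ← SimpleGraph.edgeFinset] at hle
      have hdeg : ∀ a : (X : Set V), 2 * k + 1 ≤ (H.induce (X : Set V)).degree a := by
        intro a
        refine (hcon a a.2).trans_eq ?_
        rw [← SimpleGraph.card_neighborFinset_eq_degree]
        symm
        refine card_bij (fun b _ => (b : V)) ?_ ?_ ?_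
        · intro b hb
          have := b.2
          simpa using hb
        · intro b _ c _ h
          exact Subtype.ext h
        · intro b hb
          rw [mem_filter] at hb
          exact ⟨⟨b, hb.1⟩, by simpa using hb.2, rfl⟩
      have hlow : #X * (2 * k + 1) ≤ ∑ a, (H.induce (X : Set V)).degree a := by
        refine le_trans ?_ (card_nsmul_le_sum univ _ _ fun a _ => hdeg a)
        simp
      have hpos := hX.card_pos
      nlinarith
    have hY := ih (X.erase x) (erase_ssubset hx)
      fun W hW => hH W (hW.trans (erase_subset _ _))
    have hcover : (X.powerset.filter fun Q : Finset V => H.IsClique (Q : Set V)) ⊆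
        ((X.erase x).powerset.filter fun Q : Finset V => H.IsClique (Q : Set V)) ∪
          ({y ∈ X | H.Adj x y} : Finset V).powerset.image (insert x) := by
      intro Q hQ
      simp only [mem_filter, mem_powerset, mem_union, mem_image] at hQ ⊢
      by_cases hxQ : x ∈ Q
      · refine Or.inr ⟨Q.erase x, fun y hy => ?_, insert_erase hxQ⟩
        rw [mem_erase] at hy
        exact mem_filter.2 ⟨hQ.1 hy.2, hQ.2 hxQ hy.2 hy.1.symm⟩
      · exact Or.inl ⟨subset_erase.2 ⟨hQ.1, hxQ⟩, hQ.2⟩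
    have hnbr : #(({y ∈ X | H.Adj x y} : Finset V).powerset.image (insert x)) ≤ 4 ^ k := by
      refine card_image_le.trans ?_
      rw [card_powerset, show 4 = 2 ^ 2 from rfl, ← pow_mul]
      exact Nat.pow_le_pow_right two_pos hdeg
    have hcard := card_erase_add_one hx
    calc _ ≤ _ := card_le_card hcover
      _ ≤ _ := card_union_le _ _
      _ ≤ (4 ^ k * #(X.erase x) + 1) + 4 ^ k := add_le_add hY hnbr
      _ = _ := by rw [← hcard]; ring

open Finset Classical in
/-- If depth-`1` minors of `G` have at most `k` edges per vertex, then there is a graph `H`, sparse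
on `X`, such that all but `k * |X|` vertices outside `X` have a neighbourhood in `X` that is a clique
of `H`. -/
theorem exists_sparse_graph_clique_traces [Fintype V] (G : SimpleGraph V) (k : ℕ)
    (hk : ∀ (W : Type u) [Finite W] (H : SimpleGraph W), IsShallowMinor 1 H G →
      H.edgeSet.ncard ≤ k * Nat.card W) (X : Finset V) :
    ∃ (H : SimpleGraph V) (D : Finset V),
      (∀ W ⊆ X, (H.induce (W : Set V)).edgeSet.ncard ≤ k * #W) ∧ #D ≤ k * #X ∧
      ∀ u ∉ X, u ∉ D → H.IsClique {x | x ∈ X ∧ G.Adj u x} := by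
  -- A triple `(u, a, b)` means that contracting the outside vertex `u` into its neighbour `a`
  -- creates the edge `ab`. Each `u` is spent once and each edge is created once.
  let good : Finset (V × V × V) → Prop := fun T =>
    (∀ t ∈ T, t.1 ∉ X ∧ t.2.1 ∈ X ∧ t.2.2 ∈ X ∧ t.2.1 ≠ t.2.2 ∧ G.Adj t.1 t.2.1 ∧
      G.Adj t.1 t.2.2) ∧
    (∀ t ∈ T, ∀ t' ∈ T, t.1 = t'.1 → t = t') ∧
    (∀ t ∈ T, ∀ t' ∈ T, s(t.2.1, t.2.2) = s(t'.2.1, t'.2.2) → t = t')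
  obtain ⟨T, hT⟩ : ∃ T, Maximal good T :=
    (Set.toFinite {T | good T}).exists_maximal ⟨∅, by simp [good]⟩
  obtain ⟨hmem, hinj, hedge⟩ := hT.prop
  let H : SimpleGraph V := .fromEdgeSet {e | ∃ t ∈ T, s(t.2.1, t.2.2) = e}
  have hminor : ∀ W ⊆ X, IsShallowMinor 1 (H.induce (W : Set V)) G := by
    intro W hW
    -- The branch sets are stars: `a` with the outside vertices contracted into it.
    refine ⟨fun a => {z | z = a ∨ ∃ b, (z, a.1, b) ∈ T}, ?_, ?_, ?_⟩
    · intro a b hab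
      rw [Set.disjoint_left]
      rintro z (rfl | ⟨c, hc⟩) (h | ⟨d, hd⟩)
      · exact hab (Subtype.ext h)
      · exact (hmem _ hd).1 (hW a.2)
      · exact (hmem _ hc).1 (h ▸ hW b.2)
      · have := hinj _ hc _ hd rfl
        simp only [Prod.mk.injEq] at this
        exact hab (Subtype.ext this.2.1)
    · intro a
      refine ⟨⟨a, Or.inl rfl⟩, ?_⟩
      rintro ⟨z, hz⟩
      rcases hz with rfl | ⟨c, hc⟩
      · exact ⟨.nil, by simp⟩
      · have hadj : (G.induce {z | z = (a : V) ∨ ∃ b, (z, a.1, b) ∈ T}).Adj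
            ⟨a, Or.inl rfl⟩ ⟨z, Or.inr ⟨c, hc⟩⟩ := (hmem _ hc).2.2.2.2.1.symm
        exact ⟨hadj.toWalk, by simp⟩
    · intro a b hab
      obtain ⟨⟨⟨y, c, d⟩, ht, he⟩, -⟩ := (SimpleGraph.fromEdgeSet_adj _).1 hab
      obtain ⟨-, -, -, -, h1, h2⟩ := hmem _ ht
      change s(c, d) = s(a.1, b.1) at he
      dsimp only at h1 h2
      rcases Sym2.eq_iff.1 he with ⟨h, h'⟩ | ⟨h, h'⟩
      · subst h; exact ⟨y, Or.inr ⟨d, ht⟩, b, Or.inl rfl, h' ▸ h2⟩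
      · subst h; exact ⟨a, Or.inl rfl, y, Or.inr ⟨d, ht⟩, (h' ▸ h2).symm⟩
  have hdens : ∀ W ⊆ X, (H.induce (W : Set V)).edgeSet.ncard ≤ k * #W := by
    intro W hW
    simpa using hk _ _ (hminor W hW)
  have hTcard : #T ≤ k * #X := by
    refine le_trans ?_ (hdens X subset_rfl)
    rw [← Set.ncard_image_of_injective _ (Sym2.map.injective Subtype.val_injective),
      ← Set.ncard_coe_finset]
    refine Set.ncard_le_ncard_of_injOn (fun t => s(t.2.1, t.2.2)) ?_ ?_ (Set.toFinite _)
    · intro t ht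
      obtain ⟨-, h1, h2, h3, -⟩ := hmem t ht
      refine ⟨s(⟨t.2.1, h1⟩, ⟨t.2.2, h2⟩), ?_, rfl⟩
      exact (SimpleGraph.fromEdgeSet_adj _).2 ⟨⟨t, ht, rfl⟩, h3⟩
    · intro t ht t' ht' h
      exact hedge t ht t' ht' h
  refine ⟨H, T.image Prod.fst, hdens, card_image_le.trans hTcard, ?_⟩
  intro u huX huT a ha b hb hab
  refine (SimpleGraph.fromEdgeSet_adj _).2 ⟨?_, hab⟩
  by_contra hno
  have hno' : ∀ t ∈ T, s(t.2.1, t.2.2) ≠ s(a, b) := fun t ht h => hno ⟨t, ht, h⟩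
  have huT' : ∀ t ∈ T, t.1 ≠ u := fun t ht h => huT (mem_image.2 ⟨t, ht, h⟩)
  -- An unused `u` with non-adjacent neighbours `a`, `b` could be contracted to create `ab`, against
  -- maximality.
  have hgood : good (insert (u, a, b) T) := by
    refine ⟨?_, ?_, ?_⟩
    · intro t ht
      rcases mem_insert.1 ht with rfl | ht
      · exact ⟨huX, ha.1, hb.1, hab, ha.2, hb.2⟩
      · exact hmem t ht
    · intro t ht t' ht' h
      rcases mem_insert.1 ht with rfl | ht <;> rcases mem_insert.1 ht' with rfl | ht'
      · rfl
      · exact absurd h.symm (huT' t' ht')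
      · exact absurd h (huT' t ht)
      · exact hinj t ht t' ht' h
    · intro t ht t' ht' h
      rcases mem_insert.1 ht with rfl | ht <;> rcases mem_insert.1 ht' with rfl | ht'
      · rfl
      · exact absurd h.symm (hno' t' ht')
      · exact absurd h (hno' t ht)
      · exact hedge t ht t' ht' h
  exact huT' _ (hT.le_of_ge hgood (subset_insert _ _) (mem_insert_self _ _)) rfl

open Finset Classical in
/-- Linear neighbourhood complexity: if depth-`1` minors of `G` have at most `k` edges per vertex,
then the vertices outside `X` have linearly many different neighbourhoods in `X`. -/
theorem card_traces_le [Fintype V] (G : SimpleGraph V) (k : ℕ)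
    (hk : ∀ (W : Type u) [Finite W] (H : SimpleGraph W), IsShallowMinor 1 H G →
      H.edgeSet.ncard ≤ k * Nat.card W) (X : Finset V) :
    #((univ \ X).image fun u => ({x ∈ X | G.Adj u x} : Finset V)) ≤
      (k + 4 ^ k + 1) * max 1 #X := by
  obtain ⟨H, D, hdens, hD, hclique⟩ := exists_sparse_graph_clique_traces G k hk X
  have hcover : (univ \ X).image (fun u => ({x ∈ X | G.Adj u x} : Finset V)) ⊆
      D.image (fun u => ({x ∈ X | G.Adj u x} : Finset V)) ∪
        X.powerset.filter fun Q : Finset V => H.IsClique (Q : Set V) := by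
    intro Q hQ
    obtain ⟨u, hu, rfl⟩ := mem_image.1 hQ
    by_cases huD : u ∈ D
    · exact mem_union_left _ (mem_image_of_mem _ huD)
    · refine mem_union_right _ (mem_filter.2 ⟨mem_powerset.2 (filter_subset _ _), ?_⟩)
      rw [coe_filter]
      exact hclique u (mem_sdiff.1 hu).2 huD
  have hcl := card_cliques_le H k X hdens
  calc _ ≤ _ := card_le_card hcover
    _ ≤ _ := card_union_le _ _
    _ ≤ k * #X + (4 ^ k * #X + 1) := add_le_add (card_image_le.trans hD) hcl
    _ ≤ k * max 1 #X + (4 ^ k * max 1 #X + max 1 #X) := by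
        gcongr <;> omega
    _ = _ := by ring

/-! ### Isolating a set by a flip -/

/-- The partition of the vertices into singletons on `S` and, outside `S`, into the classes of
vertices with the same neighbourhood in `S`. -/
def nbhdPartition (G : SimpleGraph V) (S : Set V) : Setoid V where
  r u v := u = v ∨ u ∉ S ∧ v ∉ S ∧ ∀ s ∈ S, G.Adj s u ↔ G.Adj s v
  iseqv :=
    { refl := fun _ => Or.inl rfl
      symm := by
        rintro u v (rfl | ⟨hu, hv, h⟩)
        · exact Or.inl rfl
        · exact Or.inr ⟨hv, hu, fun s hs => (h s hs).symm⟩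
      trans := by
        rintro u v w (rfl | ⟨hu, hv, h⟩) (rfl | ⟨hv', hw, h'⟩)
        · exact Or.inl rfl
        · exact Or.inr ⟨hv', hw, h'⟩
        · exact Or.inr ⟨hu, hv, h⟩
        · exact Or.inr ⟨hu, hw, fun s hs => (h s hs).trans (h' s hs)⟩ }

theorem nbhdPartition_rel {G : SimpleGraph V} {S : Set V} {u v : V} :
    nbhdPartition G S u v ↔ u = v ∨ u ∉ S ∧ v ∉ S ∧ ∀ s ∈ S, G.Adj s u ↔ G.Adj s v :=
  Iff.rfl

theorem nbhdPartition_antitone (G : SimpleGraph V) : Antitone (nbhdPartition G) := by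
  rintro S T hST u v (rfl | ⟨hu, hv, h⟩)
  · exact Or.inl rfl
  · exact Or.inr ⟨fun h => hu (hST h), fun h => hv (hST h), fun s hs => h s (hST hs)⟩

theorem nbhdPartition_empty (G : SimpleGraph V) : nbhdPartition G ∅ = ⊤ := by
  ext u v
  simp [nbhdPartition_rel]

theorem nbhdPartition_univ (G : SimpleGraph V) : nbhdPartition G Set.univ = ⊥ := by
  ext u v
  simp [nbhdPartition_rel]

/-- The graph `G` with all edges incident with `S` deleted. -/
def isolate (G : SimpleGraph V) (S : Set V) : SimpleGraph V where
  Adj u v := G.Adj u v ∧ u ∉ S ∧ v ∉ S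
  symm := ⟨fun _ _ h => ⟨h.1.symm, h.2.2, h.2.1⟩⟩
  loopless := ⟨fun _ h => h.1.ne rfl⟩

theorem isolate_adj {G : SimpleGraph V} {S : Set V} {u v : V} :
    (isolate G S).Adj u v ↔ G.Adj u v ∧ u ∉ S ∧ v ∉ S :=
  Iff.rfl

theorem isolate_le (G : SimpleGraph V) (S : Set V) : isolate G S ≤ G :=
  fun _ _ h => h.1

theorem isolate_antitone (G : SimpleGraph V) : Antitone (isolate G) :=
  fun _ _ hST _ _ h => ⟨h.1, fun hu => h.2.1 (hST hu), fun hv => h.2.2 (hST hv)⟩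

theorem isolate_univ (G : SimpleGraph V) : isolate G Set.univ = ⊥ := by
  ext u v
  simp [isolate_adj]

theorem isFlip_isolate (G : SimpleGraph V) (S : Set V) :
    IsFlip (nbhdPartition G S) G (isolate G S) := by
  have key : ∀ u v u' v' : V, nbhdPartition G S u' u → nbhdPartition G S v' v →
      G.Adj u' v' → u' ∈ S → G.Adj u v ∧ u ∈ S := by
    rintro u v u' v' (rfl | ⟨hu, -⟩) hv hadj hS
    · rcases hv with rfl | ⟨-, -, h⟩
      · exact ⟨hadj, hS⟩
      · exact ⟨(h _ hS).1 hadj, hS⟩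
    · exact absurd hS hu
  -- Flip the pairs of parts joined by an edge with an end in `S`. By `key`, every pair of vertices
  -- representing such parts is itself an edge meeting `S`, so nothing else changes.
  refine ⟨{e | ∃ u v : V, G.Adj u v ∧ u ∈ S ∧ e = s(Quotient.mk _ u, Quotient.mk _ v)},
    fun u v _ => ?_⟩
  have hF : (∃ u' v' : V, G.Adj u' v' ∧ u' ∈ S ∧
      s(Quotient.mk (nbhdPartition G S) u, Quotient.mk (nbhdPartition G S) v) =
        s(Quotient.mk _ u', Quotient.mk _ v')) ↔ G.Adj u v ∧ (u ∈ S ∨ v ∈ S) := by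
    constructor
    · rintro ⟨u', v', hadj, hS, he⟩
      rcases Sym2.eq_iff.1 he with ⟨h, h'⟩ | ⟨h, h'⟩
      · obtain ⟨h1, h2⟩ := key u v u' v' (Quotient.exact h.symm) (Quotient.exact h'.symm) hadj hS
        exact ⟨h1, Or.inl h2⟩
      · obtain ⟨h1, h2⟩ := key v u u' v' (Quotient.exact h'.symm) (Quotient.exact h.symm) hadj hS
        exact ⟨h1.symm, Or.inr h2⟩
    · rintro ⟨hadj, hS | hS⟩
      · exact ⟨u, v, hadj, hS, rfl⟩
      · exact ⟨v, u, hadj.symm, hS, Sym2.eq_swap⟩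
  rw [Set.mem_ofPred_eq, hF, isolate_adj]
  unfold Xor
  tauto

/-! ### Reachability after isolation, and the width of one step -/

theorem not_mem_of_mem_support_isolate {G : SimpleGraph V} {S : Set V} {v u : V}
    (p : (isolate G S).Walk v u) (hv : v ∉ S) : ∀ w ∈ p.support, w ∉ S := by
  induction p with
  | nil => simpa using hv
  | cons h p ih =>
    intro w hw
    rw [SimpleGraph.Walk.support_cons, List.mem_cons] at hw
    rcases hw with rfl | hw
    · exact hv
    · exact ih h.2.2 w hw

theorem eq_of_walk_isolate {G : SimpleGraph V} {S : Set V} {v u : V}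
    (p : (isolate G S).Walk v u) (hv : v ∈ S) : u = v := by
  cases p with
  | nil => rfl
  | cons h _ => exact absurd hv h.2.1

/-- The neighbours in `S` of a vertex at distance at most `r` from `v` in `G - S` belong to the
`(r + 1)`-separator of `v` in `S`. -/
theorem mem_sep_of_walk_isolate {G : SimpleGraph V} {S : Set V} {v u s : V} {r : ℕ}
    (p : (isolate G S).Walk v u) (hp : p.IsPath) (hlen : p.length ≤ r) (hv : v ∉ S) (hs : s ∈ S)
    (hus : G.Adj u s) : s ∈ sep G ((r + 1 : ℕ) : ℕ∞) v S := by
  have hS := not_mem_of_mem_support_isolate p hv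
  have hsupp : (p.mapLe (isolate_le G S)).support = p.support := by simp
  refine ⟨hs, (p.mapLe (isolate_le G S)).concat hus, ?_, ?_, ?_⟩
  · refine SimpleGraph.Walk.IsPath.concat ?_ ?_ hus
    · exact (SimpleGraph.Walk.isPath_mapLe _).2 hp
    · rw [hsupp]
      exact fun h => hS s h hs
  · rw [SimpleGraph.Walk.length_concat]
    simpa using hlen
  · intro w hw _ hws
    rw [SimpleGraph.Walk.support_concat, hsupp] at hw
    simp only [List.mem_append, List.mem_singleton] at hw
    exact hS w (hw.resolve_right hws)

theorem eq_of_mem_classes {P : Setoid V} {A B : Set V} (hA : A ∈ P.classes) (hB : B ∈ P.classes)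
    {a b : V} (ha : a ∈ A) (hb : b ∈ B) (hab : P a b) : A = B := by
  obtain ⟨y, rfl⟩ := hA
  obtain ⟨z, rfl⟩ := hB
  have hyz : P y z := P.trans (P.symm ha) (P.trans hab hb)
  ext w
  exact ⟨fun h => P.trans h hyz, fun h => P.trans h (P.symm hyz)⟩

/-- The bound on the width of one step of the sequence, in which the partition is defined by a set
with at most one vertex more than the set of isolated vertices. -/
theorem pairWidth_le [Finite V] (G : SimpleGraph V) (k : ℕ)
    (hk : ∀ (W : Type u) [Finite W] (H : SimpleGraph W), IsShallowMinor 1 H G →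
      H.edgeSet.ncard ≤ k * Nat.card W) (r : ℕ) (m : ℕ∞) (S T : Set V)
    (hT : ∀ a ∈ T, a ∉ S → ∀ b ∈ T, b ∉ S → a = b)
    (hm : ∀ v ∉ S, (sep G ((r + 1 : ℕ) : ℕ∞) v S).encard ≤ m) :
    pairWidth r (nbhdPartition G T) (isolate G S) ≤
      ((4 * (k + 4 ^ k + 1) : ℕ) : ℕ∞) * max 1 m := by
  classical
  have := Fintype.ofFinite V
  refine iSup_le fun v => ?_
  by_cases hv : v ∈ S
  · have hone : (reachableParts (nbhdPartition G T) (isolate G S) r v).encard ≤ 1 := by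
      rw [Set.encard_le_one_iff]
      rintro A B ⟨hA, a, haA, p, -⟩ ⟨hB, b, hbB, q, -⟩
      obtain rfl := eq_of_walk_isolate p hv
      obtain rfl := eq_of_walk_isolate q hv
      exact eq_of_mem_classes hA hB haA hbB (Setoid.refl' _ _)
    refine hone.trans (one_le_mul ?_ (le_max_left _ _))
    exact_mod_cast (by positivity : 0 < 4 * (k + 4 ^ k + 1))
  set Z := sep G ((r + 1 : ℕ) : ℕ∞) v S with hZ
  let X : Finset V := Z.toFinset
  have hreach : ∀ A ∈ reachableParts (nbhdPartition G T) (isolate G S) r v,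
      ∃ u ∈ A, u ∉ S ∧ ∀ s ∈ S, G.Adj u s → s ∈ X := by
    rintro A ⟨-, u, huA, p, hp, hlen⟩
    refine ⟨u, huA, not_mem_of_mem_support_isolate p hv u p.end_mem_support, fun s hs hus => ?_⟩
    exact Set.mem_toFinset.2 (mem_sep_of_walk_isolate p hp hlen hv hs hus)
  have : Nonempty V := ⟨v⟩
  choose! f hfA hfS hfX using hreach
  let tr : V → Finset V := fun u => {x ∈ X | G.Adj u x}
  -- A part is encoded by three data of a reached vertex: membership in `T`, adjacency to the
  -- possible single vertex of `T \ S`, and the trace on `X`. The two truth values give the factor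
  -- 4.
  let K : Finset (Prop × Prop × Finset V) :=
    Finset.univ ×ˢ Finset.univ ×ˢ (Finset.univ \ X).image tr
  have hXS : ∀ x ∈ X, x ∈ S := fun x hx => (Set.mem_toFinset.1 hx).1
  have hle : (reachableParts (nbhdPartition G T) (isolate G S) r v).encard ≤
      (K : Set (Prop × Prop × Finset V)).encard := by
    refine Set.encard_le_encard_of_injOn
      (f := fun A => (f A ∈ T, (∃ s ∈ T, s ∉ S ∧ G.Adj s (f A)), tr (f A))) ?_ ?_
    · intro A hA
      simp only [K, Finset.coe_product, Finset.coe_univ, Set.mem_prod, Set.mem_univ, true_and,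
        Finset.mem_coe]
      refine Finset.mem_image_of_mem _ (Finset.mem_sdiff.2 ⟨Finset.mem_univ _, fun h => ?_⟩)
      exact hfS A hA (hXS _ h)
    · intro A hA B hB h
      simp only [Prod.mk.injEq, eq_iff_iff] at h
      obtain ⟨h1, h2, h3⟩ := h
      refine eq_of_mem_classes hA.1 hB.1 (hfA A hA) (hfA B hB) ?_
      by_cases hAT : f A ∈ T
      · exact Or.inl (hT _ hAT (hfS A hA) _ (h1.1 hAT) (hfS B hB))
      refine Or.inr ⟨hAT, fun h => hAT (h1.2 h), fun s hs => ?_⟩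
      -- Neighbours in `S` are read off the trace, since `X` contains all of them; a remaining `s`
      -- is the unique vertex of `T \ S`.
      by_cases hsS : s ∈ S
      · have mem_tr : ∀ C ∈ reachableParts (nbhdPartition G T) (isolate G S) r v,
            (s ∈ tr (f C) ↔ G.Adj s (f C)) := by
          intro C hC
          rw [Finset.mem_filter, G.adj_comm s]
          exact ⟨fun h => h.2, fun h => ⟨hfX C hC s hsS h, h⟩⟩
        rw [← mem_tr A hA, ← mem_tr B hB, h3]
      · have only : ∀ u, (∃ t ∈ T, t ∉ S ∧ G.Adj t u) ↔ G.Adj s u := by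
          refine fun u => ⟨?_, fun h => ⟨s, hs, hsS, h⟩⟩
          rintro ⟨t, ht, htS, h⟩
          rwa [hT s hs hsS t ht htS]
        rw [← only, ← only, h2]
  refine hle.trans ?_
  have hK : K.card ≤ 4 * (k + 4 ^ k + 1) * max 1 X.card := by
    have := card_traces_le G k hk X
    simp only [K, Finset.card_product, Finset.card_univ, Fintype.card_prop]
    calc _ ≤ 2 * (2 * ((k + 4 ^ k + 1) * max 1 X.card)) := by gcongr
      _ = _ := by ring
  have hXm : (X.card : ℕ∞) ≤ m := by
    rw [← Set.encard_coe_eq_coe_finsetCard, Set.coe_toFinset]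
    exact hm v hv
  rw [Set.encard_coe_eq_coe_finsetCard]
  calc ((K.card : ℕ) : ℕ∞) ≤ ((4 * (k + 4 ^ k + 1) * max 1 X.card : ℕ) : ℕ∞) := by
        exact_mod_cast hK
    _ = ((4 * (k + 4 ^ k + 1) : ℕ) : ℕ∞) * max 1 (X.card : ℕ∞) := by push_cast; rfl
    _ ≤ _ := by gcongr

/-! ### From a vertex order to a flip sequence -/

/-- The flip sequence that isolates an increasing chain of vertex sets. -/
noncomputable def chainFlipSequence (G : SimpleGraph V) (n : ℕ) (S : ℕ → Set V) (hS : Monotone S)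
    (h0 : S 0 = ∅) (hn : S n = Set.univ) : RestrainedFlipSequence G where
  -- Truncated subtraction makes indices 0 and 1 both use `S 0 = ∅`. Thus the complete graph
  -- required at index 0 is paired with the trivial partition, for width at most 1.
  len := n + 1
  part i := nbhdPartition G (S (i - 1))
  res i := if (i : ℕ) = 0 then ⊤ else isolate G (S (i - 1))
  flip i := isolate G (S (i - 1))
  part_refines i j hij := nbhdPartition_antitone G (hS (Nat.sub_le_sub_right hij 1))
  part_first := by simp [h0, nbhdPartition_empty]
  part_last := by simp [hn, nbhdPartition_univ]
  isFlip i := isFlip_isolate G _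
  res_decreasing i j hij := by
    dsimp only
    split_ifs with hj hi
    · exact le_rfl
    · have : (i : ℕ) ≤ j := hij
      omega
    · exact le_top
    · exact isolate_antitone G (hS (Nat.sub_le_sub_right hij 1))
  res_first := by simp
  res_last := by simp [hn, isolate_univ]
  flip_le_res i := by
    split_ifs
    · exact le_top
    · exact le_rfl

theorem mw_le_orderSepWidth [Finite V] [LinearOrder V] (G : SimpleGraph V) (k : ℕ)
    (hk : ∀ (W : Type u) [Finite W] (H : SimpleGraph W), IsShallowMinor 1 H G →
      H.edgeSet.ncard ≤ k * Nat.card W) (r : ℕ) :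
    mw r G ≤ ((4 * (k + 4 ^ k + 1) : ℕ) : ℕ∞) *
      max 1 (orderSepWidth G ((r + 1 : ℕ) : ℕ∞)) := by
  have := Fintype.ofFinite V
  let e : V ≃o Fin (Fintype.card V) := (Fintype.orderIsoFinOfCardEq V rfl).symm
  let S : ℕ → Set V := fun j => {v | (e v : ℕ) < j}
  have hS : Monotone S := fun i j hij v (hv : (e v : ℕ) < i) => hv.trans_le hij
  have h0 : S 0 = ∅ := by simp [S]
  have hn : S (Fintype.card V) = Set.univ := by simp [S]
  refine (iInf_le _ (chainFlipSequence G _ S hS h0 hn)).trans (iSup_le fun i => ?_)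
  obtain ⟨_ | j, hi⟩ := i
  · refine iSup_le fun v => ?_
    have hone : (reachableParts (nbhdPartition G (S 0))
        ((chainFlipSequence G _ S hS h0 hn).res 0) r v).encard ≤ 1 := by
      rw [Set.encard_le_one_iff, h0, nbhdPartition_empty]
      rintro A B ⟨hA, a, haA, -⟩ ⟨hB, b, hbB, -⟩
      exact eq_of_mem_classes hA hB haA hbB trivial
    refine hone.trans (one_le_mul ?_ (le_max_left _ _))
    exact_mod_cast (by positivity : 0 < 4 * (k + 4 ^ k + 1))
  -- The restraint at index `j + 1` isolates `S j`, while the partition at index `j + 2` comes from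
  -- `S (j + 1)`, one vertex larger at most.
  · refine pairWidth_le G k hk r _ (S j) (S (j + 1)) ?_ ?_
    · intro a ha haS b hb hbS
      simp only [S, Set.mem_ofPred_eq] at ha haS hb hbS
      exact e.injective (Fin.ext (by omega))
    · intro v hv
      have hlow : IsLowerSet (S j) := fun a b hba ha =>
        lt_of_le_of_lt (Fin.le_def.1 (e.monotone hba)) ha
      exact le_iSup_of_le (S j) (le_iSup_of_le hlow (le_iSup_of_le v (le_iSup_of_le hv le_rfl)))

end SparseMerge

theorem corollary6p4 (C : SparseMerge.GraphClass.{u}) (hC : C.BoundedExpansion) :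
    ∃ c : ℕ, ∀ r : ℕ, 1 ≤ r → ∀ (V : Type u) [Finite V] (G : SimpleGraph V), C V G →
      SparseMerge.mw r G ≤ (c : ℕ∞) * max 1 (SparseMerge.sw ((r + 1 : ℕ) : ℕ∞) G) := by
  obtain ⟨k, hk⟩ := hC 1
  refine ⟨4 * (k + 4 ^ k + 1), fun r _ V _ G hG => ?_⟩
  have : Nonempty (LinearOrder V) := by
    have := Fintype.ofFinite V
    exact ⟨LinearOrder.lift' (Fintype.equivFin V) (Fintype.equivFin V).injective⟩
  -- An infimum over a nonempty family in `ℕ∞` is attained, so an optimal order exists.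
  obtain ⟨L, hL⟩ := ciInf_mem fun L : LinearOrder V =>
    @SparseMerge.orderSepWidth V L G ((r + 1 : ℕ) : ℕ∞)
  rw [SparseMerge.sw, ← hL]
  exact @SparseMerge.mw_le_orderSepWidth V _ L G k (fun W _ H => hk V G hG W H) r
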